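/- Consider words over the five letters "hamburger produced", "cheeseburger produced", "hamburger ordered", "cheeseburger ordered", "fresh order". Reading a word from left to right, a produced burger is put on top of an initially empty stack; an order of a given type removes the topmost burger of that type; a fresh order removes the top burger whatever its type. A word is *perfect of order $n$* if it has length $2n$, every order is fulfilled by a burger already on the stack, and the stack ends empty. Let $\Theta_n^0$ be the set of perfect words of order $n$ that contain no fresh order. For integers $n,k,s\ge 0$ with $k\le 2n$, let $W$ be uniform on $\Theta_n^0$ and, independently, let $i_1<\dots<i_k$ be a uniformly random $k$-subset of $\{1,\dots,2n\}$ in increasing order. Let $w_j=W[\max(i_j-s+1,1),\,i_j]$ be the subword of $W$ from position $\max(i_j-s+1,1)$ through position $i_j$ inclusive, so that $w_j$ has length $s$ unless $i_j<s$. Let $\hat w_1,\dots,\hat w_k$ be i.i.d. uniformly random words of length $s$ over the four letters other than the fresh order, independent of $(i_1,\dots,i_k)$. Theorem. For every $\varepsilon>0$ there is $\delta>0$, depending only on $\varepsilon$, such that for all integers $n,k,s\ge0$ with $k\le 2n$ and $k^3s^2\le\delta n$: 1. with probability at least $1-\varepsilon$ the subwords $w_1,\dots,w_k$ are nonoverlapping,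 i.e. the position intervals $[\max(i_j-s+1,1),\,i_j]$ are pairwise disjoint; 2. the total variation distance between the joint law of $\big((i_1,\dots,i_k),(w_1,\dots,w_k)\big)$ and the joint law of $\big((i_1,\dots,i_k),(\hat w_1,\dots,\hat w_k)\big)$ is at most $\varepsilon$. -/

import Mathlib

namespace BurgerWords

/-- The two types of burger. -/
inductive Burger
  | ham
  | cheese
  deriving DecidableEq

/-- The five-letter alphabet: production of a burger of a given type, an order of a burger of a
given type, and a fresh order (for the burger on top of the stack, whatever its type). -/
inductive Letter
  | burger (b : Burger)
  | order (b : Burger)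
  | fresh
  deriving DecidableEq

instance : Fintype Letter where
  elems := {.burger .ham, .burger .cheese, .order .ham, .order .cheese, .fresh}
  complete x := by rcases x with (_ | _) | (_ | _) | _ <;> simp

/-- The effect of one letter on the burger stack (head of the list = top of the stack); `none` if
the order cannot be fulfilled. `List.erase` removes the first, i.e. the topmost, occurrence. -/
def step : List Burger → Letter → Option (List Burger)
  | st, .burger b => some (b :: st)
  | st, .order b => if b ∈ st then some (st.erase b) else none
  | [], .fresh => none
  | _ :: st, .fresh => some st

/-- The stack after reading a word from left to right, starting from the empty stack; `none` if
some order is not fulfilled. -/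
def stackAfter (w : List Letter) : Option (List Burger) :=
  w.foldlM step []

/-- Every order is fulfilled by a burger already on the stack, and the stack ends empty. -/
def IsPerfect (w : List Letter) : Prop :=
  stackAfter w = some []

/-- The perfect words of order `n` (of length `2 * n`) with exactly `k` fresh orders, each of
which is fulfilled by a cheeseburger. -/
def Theta (n k : ℕ) : Set (List Letter) :=
  {w | IsPerfect w ∧ w.length = 2 * n ∧ w.count Letter.fresh = k ∧
    ∀ u v, w = u ++ Letter.fresh :: v → ∃ st, stackAfter u = some (Burger.cheese :: st)}

/-- The words of length `s` over the four letters other than the fresh order. -/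
def plainWords (s : ℕ) : Set (List Letter) :=
  {w | w.length = s ∧ Letter.fresh ∉ w}

/-- The increasing `k`-tuples `i_1 < ⋯ < i_k` of elements of `{1, …, 2 * n}`. -/
def indexTuples (n k : ℕ) : Set (Fin k → ℕ) :=
  {i | StrictMono i ∧ ∀ j, i j ∈ Finset.Icc 1 (2 * n)}

theorem theta_finite (n k : ℕ) : (Theta n k).Finite :=
  (List.finite_length_eq Letter (2 * n)).subset fun _ h => h.2.1

theorem theta_zero_nonempty (n : ℕ) : (Theta n 0).Nonempty := by
  have key : ∀ m : ℕ, ∃ w : List Letter, IsPerfect w ∧ w.length = 2 * m ∧ Letter.fresh ∉ w := by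
    intro m
    induction m with
    | zero => exact ⟨[], rfl, rfl, by simp⟩
    | succ m ih =>
      obtain ⟨w, h1, h2, h3⟩ := ih
      refine ⟨.burger .ham :: .order .ham :: w, ?_, ?_, ?_⟩
      · simpa [IsPerfect, stackAfter, step] using h1
      · simp [h2]; ring
      · simpa using h3
  obtain ⟨w, h1, h2, h3⟩ := key n
  refine ⟨w, h1, h2, List.count_eq_zero.2 h3, ?_⟩
  rintro u v rfl
  simp at h3

theorem plainWords_finite (s : ℕ) : (plainWords s).Finite :=
  (List.finite_length_eq Letter s).subset fun _ h => h.1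

theorem plainWords_nonempty (s : ℕ) : (plainWords s).Nonempty :=
  ⟨List.replicate s (.burger .ham), by simp, by simp [List.mem_replicate]⟩

theorem plainTuples_finite (k s : ℕ) : (Set.univ.pi fun _ : Fin k => plainWords s).Finite :=
  Set.Finite.pi fun _ => plainWords_finite s

theorem plainTuples_nonempty (k s : ℕ) :
    (Set.univ.pi fun _ : Fin k => plainWords s).Nonempty :=
  Set.univ_pi_nonempty_iff.2 fun _ => plainWords_nonempty s

theorem indexTuples_finite (n k : ℕ) : (indexTuples n k).Finite :=
  (Set.Finite.pi' fun _ : Fin k => (Finset.Icc 1 (2 * n)).finite_toSet).subset fun _ h => h.2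

theorem indexTuples_nonempty {n k : ℕ} (hk : k ≤ 2 * n) : (indexTuples n k).Nonempty := by
  refine ⟨fun j => j + 1, fun a b h => by simpa using h, fun j => ?_⟩
  have := j.2
  simp only [Finset.mem_Icc]
  omega

/-- The uniform distribution on a finite nonempty set. -/
noncomputable def uniform {α : Type*} (S : Set α) (hf : S.Finite) (hne : S.Nonempty) : PMF α :=
  PMF.uniformOfFinset hf.toFinset (hf.toFinset_nonempty.2 hne)

/-- The joint law of two independent random variables with laws `p` and `q`. -/
noncomputable def indep {α β : Type*} (p : PMF α) (q : PMF β) : PMF (α × β) :=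
  p.bind fun a => q.map fun b => (a, b)

/-- The probability of an event. -/
noncomputable def prob {α : Type*} (p : PMF α) (A : Set α) : ℝ :=
  (p.toOuterMeasure A).toReal

/-- The total variation distance `sup_A |p(A) - q(A)|`. -/
noncomputable def tvDist {α : Type*} (p q : PMF α) : ℝ :=
  ⨆ A : Set α, |prob p A - prob q A|

/-- A uniform word of `Theta n 0` and independent uniform indices `i_1 < ⋯ < i_k`. -/
noncomputable def sample (n k : ℕ) (hk : k ≤ 2 * n) : PMF (List Letter × (Fin k → ℕ)) :=
  indep (uniform (Theta n 0) (theta_finite n 0) (theta_zero_nonempty n))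
    (uniform (indexTuples n k) (indexTuples_finite n k) (indexTuples_nonempty hk))

/-- `W[a, b]`: the subword from position `a` through position `b` inclusive; positions are counted
from `1`. -/
def subword (W : List Letter) (a b : ℕ) : List Letter :=
  (W.take b).drop (a - 1)

/-- The first position `max (i - s + 1) 1` of the subword of length `s` that ends at position `i`
(cut off at the front of the word). -/
def firstPos (s i : ℕ) : ℕ :=
  max (i + 1 - s) 1

/-- The subwords `w_j = W[max (i_j - s + 1) 1, i_j]` for `j = 1, …, k`. -/
def subwords {k : ℕ} (s : ℕ) (W : List Letter) (i : Fin k → ℕ) : Fin k → List Letter :=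
  fun j => subword W (firstPos s (i j)) (i j)

/-- No two of the `k` subwords share a position. -/
def Nonoverlapping {k : ℕ} (s : ℕ) (i : Fin k → ℕ) : Prop :=
  Pairwise fun a b : Fin k =>
    Disjoint (Finset.Icc (firstPos s (i a)) (i a)) (Finset.Icc (firstPos s (i b)) (i b))

/-- The joint law of the indices and the subwords ending at them. -/
noncomputable def subwordLaw (n k s : ℕ) (hk : k ≤ 2 * n) :
    PMF ((Fin k → ℕ) × (Fin k → List Letter)) :=
  (sample n k hk).map fun x => (x.2, subwords s x.1 x.2)

/-- The law of `k` i.i.d. uniform words of length `s` over the four letters other than the fresh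
order: the uniform distribution on `k`-tuples of such words. -/
noncomputable def iidWords (k s : ℕ) : PMF (Fin k → List Letter) :=
  uniform (Set.univ.pi fun _ => plainWords s) (plainTuples_finite k s) (plainTuples_nonempty k s)

/-- The joint law of uniform indices `i_1 < ⋯ < i_k` and, independently of them, `k` i.i.d.
uniform words of length `s`. -/
noncomputable def idealLaw (n k s : ℕ) (hk : k ≤ 2 * n) :
    PMF ((Fin k → ℕ) × (Fin k → List Letter)) :=
  indep (uniform (indexTuples n k) (indexTuples_finite n k) (indexTuples_nonempty hk))
    (iidWords k s)

end BurgerWords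

/-! The proof is an entropy argument. Without fresh orders only the two burger counts matter, so
perfect words are quarter-plane excursions, and these make up at least a fraction `(n + 1) ^ (-6)`
of all `16 ^ n` plain words (`sixteen_pow_le`). Hence a uniform perfect word has entropy within `6 *
log (n + 1)` of the maximum `2 * n * log 4`.

By the chain rule this deficit is a sum of nonnegative defects, one for each position
(`sum_entropyDefect_le`). Conditioning on fewer letters raises entropy, so the letters at any set of
positions lack at most the sum of their own defects (`card_mul_log_add_meanLogFiber_le`). A random
window system covers a given position at most `k * s / (2 * n)` times on average, so its mean defect
is at most `k * s / (2 * n) * 6 * log (n + 1)`, which is small when `(k * s) ^ 2 ≤ δ * n`. A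
Pinsker-type inequality (`abs_card_div_sub_le`) turns small defect into small total variation
distance.

Overlapping or cut-off windows are rare by union bounds (`card_filter_overlap_le`,
`card_filter_lt_le`).

Entropies are expressed by mean logarithms of fibre sizes: `meanLogFiber Ω h - meanLogFiber Ω (x,
h)` is the conditional entropy of `x` given `h`. -/

open Finset Real

namespace BurgerWords

/-! ### Entropy at a uniform point of a finite set -/

section Entropy
open Classical in
/-- The number of points of `Ω` that `f` does not distinguish from `a`. -/
noncomputable def fiberCard {α β : Type*} (Ω : Finset α) (f : α → β) (a : α) : ℝ :=
  #{b ∈ Ω | f b = f a}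

/-- The mean of the logarithm of the fibre size of `f`; the entropy of `f` at a uniform point of
`Ω` is `log #Ω` minus this quantity. -/
noncomputable def meanLogFiber {α β : Type*} (Ω : Finset α) (f : α → β) : ℝ :=
  (∑ a ∈ Ω, log (fiberCard Ω f a)) / #Ω

variable {α β γ κ : Type*} {Ω : Finset α}

theorem fiberCard_pos {f : α → β} {a : α} (ha : a ∈ Ω) : 0 < fiberCard Ω f a := by
  classical
  unfold fiberCard
  exact_mod_cast card_pos.2 ⟨a, by simp [ha]⟩

theorem fiberCard_congr {f : α → β} {a b : α} (h : f a = f b) :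
    fiberCard Ω f a = fiberCard Ω f b := by
  unfold fiberCard; rw [h]

theorem fiberCard_mono {f : α → β} {g : α → γ} (h : ∀ a ∈ Ω, ∀ b ∈ Ω, f a = f b → g a = g b)
    {a : α} (ha : a ∈ Ω) : fiberCard Ω f a ≤ fiberCard Ω g a := by
  classical
  unfold fiberCard
  exact_mod_cast card_le_card fun b hb => by
    simp only [mem_filter] at hb ⊢
    exact ⟨hb.1, h _ hb.1 _ ha hb.2⟩

theorem meanLogFiber_mono {f : α → β} {g : α → γ}
    (h : ∀ a ∈ Ω, ∀ b ∈ Ω, f a = f b → g a = g b) : meanLogFiber Ω f ≤ meanLogFiber Ω g := by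
  unfold meanLogFiber
  gcongr with a ha
  · exact fiberCard_pos ha
  · exact fiberCard_mono h ha

theorem meanLogFiber_congr {f : α → β} {g : α → γ}
    (h : ∀ a ∈ Ω, ∀ b ∈ Ω, f a = f b ↔ g a = g b) : meanLogFiber Ω f = meanLogFiber Ω g :=
  le_antisymm (meanLogFiber_mono fun a ha b hb => (h a ha b hb).1)
    (meanLogFiber_mono fun a ha b hb => (h a ha b hb).2)

-- The sum is 1 if `y` is attained on `Ω` and 0 otherwise. It collapses the inner sums in the two
-- entropy inequalities below.
open Classical in
theorem sum_inv_fiberCard_le_one (f : α → β) (y : β) :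
    ∑ a ∈ Ω with f a = y, (fiberCard Ω f a)⁻¹ ≤ 1 := by
  have h : ∀ a ∈ Ω.filter (fun a => f a = y),
      (fiberCard Ω f a)⁻¹ = ((#{b ∈ Ω | f b = y} : ℕ) : ℝ)⁻¹ := by
    intro a ha
    rw [mem_filter] at ha
    unfold fiberCard
    rw [ha.2]
  rw [sum_congr rfl h, sum_const, nsmul_eq_mul]
  exact mul_inv_le_one

/-- Jensen's inequality in the form in which it is used here. -/
theorem sum_log_sub_le_zero {u v : α → ℝ} (hu : ∀ a ∈ Ω, 0 < u a) (hv : ∀ a ∈ Ω, 0 < v a)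
    (h : ∑ a ∈ Ω, u a / v a ≤ #Ω) : ∑ a ∈ Ω, (log (u a) - log (v a)) ≤ 0 := by
  calc ∑ a ∈ Ω, (log (u a) - log (v a)) ≤ ∑ a ∈ Ω, (u a / v a - 1) := by
        refine sum_le_sum fun a ha => ?_
        rw [← log_div (hu a ha).ne' (hv a ha).ne']
        exact log_le_sub_one_of_pos (div_pos (hu a ha) (hv a ha))
    _ ≤ 0 := by simpa [sum_sub_distrib] using h

/-- Conditioning on more information reduces the entropy of `x`. -/
theorem meanLogFiber_sub_le_of_finer (x : α → κ) {g : α → β} {h : α → γ}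
    (hgh : ∀ a ∈ Ω, ∀ b ∈ Ω, h a = h b → g a = g b) :
    meanLogFiber Ω h - meanLogFiber Ω (fun a => (x a, h a)) ≤
      meanLogFiber Ω g - meanLogFiber Ω (fun a => (x a, g a)) := by
  classical
  set xh : α → κ × γ := fun a => (x a, h a) with hxh
  set xg : α → κ × β := fun a => (x a, g a) with hxg
  have key : ∑ a ∈ Ω, (log (fiberCard Ω h a * fiberCard Ω xg a)
      - log (fiberCard Ω xh a * fiberCard Ω g a)) ≤ 0 := by
    refine sum_log_sub_le_zero (fun a ha => mul_pos (fiberCard_pos ha) (fiberCard_pos ha))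
      (fun a ha => mul_pos (fiberCard_pos ha) (fiberCard_pos ha)) ?_
    -- The two fibre sizes in the numerator become sums over `b` and `c`. Since `h b = h a` forces
    -- `g b = g a`, the remaining `g`-data depend on `b` alone, and for fixed `b` and `c` the
    -- admissible `a` fill at most one fibre of `xh`, with total weight at most 1.
    calc ∑ a ∈ Ω, fiberCard Ω h a * fiberCard Ω xg a / (fiberCard Ω xh a * fiberCard Ω g a)
        = ∑ a ∈ Ω, ∑ b ∈ Ω, ∑ c ∈ Ω, if h b = h a ∧ x c = x a ∧ g c = g b then
            (fiberCard Ω g b)⁻¹ * (fiberCard Ω xh a)⁻¹ else 0 := by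
          refine sum_congr rfl fun a ha => ?_
          have e : fiberCard Ω h a = ∑ b ∈ Ω, if h b = h a then (1 : ℝ) else 0 := by
            simp [fiberCard]
          rw [e, sum_mul, sum_div]
          refine sum_congr rfl fun b hb => ?_
          by_cases hba : h b = h a
          · have hg := hgh b hb a ha hba
            have e' : fiberCard Ω xg a = ∑ c ∈ Ω, if x c = x a ∧ g c = g b then (1 : ℝ) else 0 := by
              simp [fiberCard, hxg, hg]
            rw [if_pos hba, e', one_mul, sum_div]
            refine sum_congr rfl fun c _ => ?_
            rw [fiberCard_congr (Ω := Ω) hg]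
            simp only [hba, true_and]
            split_ifs <;> simp [div_eq_mul_inv, mul_comm]
          · simp [hba]
      _ = ∑ b ∈ Ω, ∑ c ∈ Ω, ∑ a ∈ Ω, if h b = h a ∧ x c = x a ∧ g c = g b then
            (fiberCard Ω g b)⁻¹ * (fiberCard Ω xh a)⁻¹ else 0 := by
          rw [sum_comm]
          refine sum_congr rfl fun b _ => sum_comm
      _ ≤ ∑ b ∈ Ω, ∑ c ∈ Ω, if g c = g b then (fiberCard Ω g b)⁻¹ else 0 := by
          refine sum_le_sum fun b hb => sum_le_sum fun c _ => ?_
          by_cases hc : g c = g b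
          · simp only [hc, and_true, if_true]
            rw [← sum_filter, ← mul_sum]
            refine mul_le_of_le_one_right (inv_nonneg.2 (fiberCard_pos hb).le) ?_
            have := sum_inv_fiberCard_le_one (Ω := Ω) xh (x c, h b)
            refine le_trans (le_of_eq (sum_congr ?_ fun _ _ => rfl)) this
            ext a
            simp only [hxh, mem_filter, Prod.mk.injEq, eq_comm, and_comm]
          · simp [hc]
      _ = ∑ b ∈ Ω, 1 := by
          refine sum_congr rfl fun b hb => ?_
          rw [← sum_filter, sum_const, nsmul_eq_mul]
          exact mul_inv_cancel₀ (fiberCard_pos (f := g) hb).ne'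
      _ = #Ω := by simp
  unfold meanLogFiber
  rw [← sub_div, ← sub_div, ← sum_sub_distrib, ← sum_sub_distrib]
  refine div_le_div_of_nonneg_right ?_ (Nat.cast_nonneg _)
  rw [← sub_nonpos, ← sum_sub_distrib]
  refine le_trans (le_of_eq (sum_congr rfl fun a ha => ?_)) key
  rw [log_mul (fiberCard_pos ha).ne' (fiberCard_pos ha).ne',
    log_mul (fiberCard_pos ha).ne' (fiberCard_pos ha).ne']
  ring

/-- The conditional entropy of `x` is at most the logarithm of the number of its values. -/
theorem meanLogFiber_sub_le_log_card (x : α → κ) (h : α → γ) (T : Finset κ)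
    (hT : ∀ a ∈ Ω, x a ∈ T) (hΩ : Ω.Nonempty) :
    meanLogFiber Ω h - meanLogFiber Ω (fun a => (x a, h a)) ≤ log #T := by
  classical
  set xh : α → κ × γ := fun a => (x a, h a) with hxh
  have hTpos : (0 : ℝ) < #T := by
    obtain ⟨a, ha⟩ := hΩ
    exact_mod_cast card_pos.2 ⟨_, hT a ha⟩
  have hΩpos : (0 : ℝ) < #Ω := by exact_mod_cast card_pos.2 hΩ
  have key : ∑ a ∈ Ω, (log (fiberCard Ω h a) - log (#T * fiberCard Ω xh a)) ≤ 0 := by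
    refine sum_log_sub_le_zero (fun a ha => fiberCard_pos ha)
      (fun a ha => mul_pos hTpos (fiberCard_pos ha)) ?_
    -- The same device: inserting the sum over the value `t` of `x a` lets `a` be summed first, over
    -- one fibre of `xh`.
    calc ∑ a ∈ Ω, fiberCard Ω h a / (#T * fiberCard Ω xh a)
        = ∑ a ∈ Ω, ∑ b ∈ Ω, ∑ t ∈ T, if h a = h b ∧ x a = t then
            (#T : ℝ)⁻¹ * (fiberCard Ω xh a)⁻¹ else 0 := by
          refine sum_congr rfl fun a ha => ?_
          have e : fiberCard Ω h a = ∑ b ∈ Ω, if h a = h b then (1 : ℝ) else 0 := by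
            simp [fiberCard, eq_comm]
          rw [e, sum_div]
          refine sum_congr rfl fun b hb => ?_
          by_cases hba : h a = h b
          · simp [hba, hT a ha, div_eq_mul_inv, mul_comm]
          · simp [hba]
      _ = ∑ b ∈ Ω, ∑ t ∈ T, ∑ a ∈ Ω, if h a = h b ∧ x a = t then
            (#T : ℝ)⁻¹ * (fiberCard Ω xh a)⁻¹ else 0 := by
          rw [sum_comm]
          refine sum_congr rfl fun b _ => sum_comm
      _ ≤ ∑ b ∈ Ω, ∑ t ∈ T, (#T : ℝ)⁻¹ := by
          refine sum_le_sum fun b hb => sum_le_sum fun t _ => ?_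
          rw [← sum_filter, ← mul_sum]
          refine mul_le_of_le_one_right (inv_nonneg.2 hTpos.le) ?_
          have := sum_inv_fiberCard_le_one (Ω := Ω) xh (t, h b)
          refine le_trans (le_of_eq (sum_congr ?_ fun _ _ => rfl)) this
          ext a
          simp only [hxh, mem_filter, Prod.mk.injEq, and_comm]
      _ = #Ω := by
          rw [sum_const, sum_const, nsmul_eq_mul, nsmul_eq_mul, mul_inv_cancel₀ hTpos.ne', mul_one]
  unfold meanLogFiber
  rw [← sub_div, ← sum_sub_distrib, div_le_iff₀ hΩpos, ← sub_nonpos]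
  refine le_trans (le_of_eq ?_) key
  rw [mul_comm, ← nsmul_eq_mul, ← sum_const, ← sum_sub_distrib]
  refine sum_congr rfl fun a ha => ?_
  rw [log_mul hTpos.ne' (fiberCard_pos ha).ne']
  ring

/-- This is `log y ≤ y - 1` at `y = √q / √p`. Summed over probability vectors, the terms `p - q`
cancel, and relative entropy dominates the squared Hellinger distance. -/
theorem mul_log_div_ge {p q : ℝ} (hp : 0 ≤ p) (hq : 0 < q) :
    (√p - √q) ^ 2 + p - q ≤ p * log (p / q) := by
  rcases hp.eq_or_lt with rfl | hp
  · simp [sq_sqrt hq.le]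
  have h1 : log (√q / √p) ≤ √q / √p - 1 :=
    log_le_sub_one_of_pos (div_pos (sqrt_pos.2 hq) (sqrt_pos.2 hp))
  have h2 : log (√q / √p) = - (log (p / q)) / 2 := by
    rw [← sqrt_div hq.le, log_sqrt (div_pos hq hp).le, ← inv_div p q, log_inv]
  have h3 : p * (√q / √p) = √p * √q := by
    nth_rewrite 1 [← mul_self_sqrt hp.le]
    field_simp
  have h4 : p * (√q / √p - 1) ≥ p * (- (log (p / q)) / 2) :=
    mul_le_mul_of_nonneg_left (h2 ▸ h1) hp.le
  have := sq_sqrt hp.le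
  have := sq_sqrt hq.le
  nlinarith

/-- Cauchy–Schwarz for `|p - q| = |√p - √q| * (√p + √q)`: the first factor is controlled by the
Hellinger bound, the second has square sum at most 4. Pinsker's sharp constant 2 is not needed. -/
theorem sq_sum_abs_sub_le {T : Finset β} {p q : β → ℝ} (hp : ∀ t ∈ T, 0 ≤ p t)
    (hq : ∀ t ∈ T, 0 < q t) (hp1 : ∑ t ∈ T, p t = 1) (hq1 : ∑ t ∈ T, q t = 1) :
    (∑ t ∈ T, |p t - q t|) ^ 2 ≤ 4 * ∑ t ∈ T, p t * log (p t / q t) := by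
  have h1 : ∑ t ∈ T, (√(p t) - √(q t)) ^ 2 ≤ ∑ t ∈ T, p t * log (p t / q t) := by
    have := sum_le_sum fun t ht => mul_log_div_ge (hp t ht) (hq t ht)
    rw [sum_sub_distrib, sum_add_distrib, hp1, hq1] at this
    linarith
  have h2 : ∑ t ∈ T, (√(p t) + √(q t)) ^ 2 ≤ 4 := by
    calc _ ≤ ∑ t ∈ T, (2 * p t + 2 * q t) := sum_le_sum fun t ht => by
          have := sq_sqrt (hp t ht)
          have := sq_sqrt (hq t ht).le
          nlinarith [sq_nonneg (√(p t) - √(q t))]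
      _ = 4 := by rw [sum_add_distrib, ← mul_sum, ← mul_sum, hp1, hq1]; norm_num
  calc (∑ t ∈ T, |p t - q t|) ^ 2
      = (∑ t ∈ T, |√(p t) - √(q t)| * (√(p t) + √(q t))) ^ 2 := by
        congr 1
        refine sum_congr rfl fun t ht => ?_
        have e : p t - q t = (√(p t) - √(q t)) * (√(p t) + √(q t)) := by
          linear_combination sq_sqrt (hq t ht).le - sq_sqrt (hp t ht)
        rw [e, abs_mul, abs_of_nonneg (add_nonneg (sqrt_nonneg (p t)) (sqrt_nonneg (q t)))]
    _ ≤ (∑ t ∈ T, |√(p t) - √(q t)| ^ 2) * ∑ t ∈ T, (√(p t) + √(q t)) ^ 2 :=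
        sum_mul_sq_le_sq_mul_sq _ _ _
    _ ≤ (∑ t ∈ T, p t * log (p t / q t)) * 4 := by
        simp only [sq_abs]
        exact mul_le_mul h1 h2 (sum_nonneg fun _ _ => sq_nonneg _)
          ((sum_nonneg fun _ _ => sq_nonneg _).trans h1)
    _ = _ := mul_comm _ _

open Classical in
/-- A Pinsker-type bound for the distance of the law of `f` from the uniform law on `T`. -/
theorem abs_card_div_sub_le {f : α → β} {T : Finset β} (hf : ∀ a ∈ Ω, f a ∈ T) (hΩ : Ω.Nonempty)
    (A : Set β) :
    |(#{a ∈ Ω | f a ∈ A} : ℝ) / #Ω - (#{t ∈ T | t ∈ A} : ℝ) / #T| ≤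
      2 * √(log #T - log #Ω + meanLogFiber Ω f) := by
  have hTpos : (0 : ℝ) < #T := by
    obtain ⟨a, ha⟩ := hΩ
    exact_mod_cast card_pos.2 ⟨_, hf a ha⟩
  have hΩpos : (0 : ℝ) < #Ω := by exact_mod_cast card_pos.2 hΩ
  set p : β → ℝ := fun t => (#{a ∈ Ω | f a = t} : ℝ) / #Ω with hp
  set q : β → ℝ := fun _ => (#T : ℝ)⁻¹ with hq
  have hfib : ∀ F : β → ℝ, ∑ t ∈ T, p t * F t = (∑ a ∈ Ω, F (f a)) / #Ω := by
    intro F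
    rw [← sum_fiberwise_of_maps_to hf, sum_div]
    refine sum_congr rfl fun t _ => ?_
    rw [sum_congr rfl (g := fun _ => F t) fun a ha => by rw [(mem_filter.1 ha).2], sum_const,
      nsmul_eq_mul, hp]
    ring
  have hp1 : ∑ t ∈ T, p t = 1 := by
    have := hfib fun _ => 1
    simpa [hΩpos.ne'] using this
  have hq1 : ∑ t ∈ T, q t = 1 := by simp [hq, hTpos.ne']
  -- The entropy of `f` falls short of `log #T` by its relative entropy to the uniform law.
  have hD : ∑ t ∈ T, p t * log (p t / q t) = log #T - log #Ω + meanLogFiber Ω f := by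
    rw [hfib fun t => log (p t / q t)]
    unfold meanLogFiber
    rw [div_eq_iff hΩpos.ne', add_mul, div_mul_cancel₀ _ hΩpos.ne', mul_comm, ← nsmul_eq_mul,
      ← sum_const, ← sum_add_distrib]
    refine sum_congr rfl fun a ha => ?_
    have e : p (f a) / q (f a) = #T / #Ω * fiberCard Ω f a := by
      simp only [hp, hq, fiberCard]
      field_simp
    rw [e, log_mul (by positivity) (fiberCard_pos ha).ne', log_div hTpos.ne' hΩpos.ne']
  have hA : (#{a ∈ Ω | f a ∈ A} : ℝ) / #Ω - (#{t ∈ T | t ∈ A} : ℝ) / #T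
      = ∑ t ∈ T with t ∈ A, (p t - q t) := by
    rw [sum_sub_distrib, sum_const, nsmul_eq_mul, sum_filter]
    have := hfib fun t => if t ∈ A then 1 else 0
    simp only [mul_ite, mul_one, mul_zero] at this
    rw [this, sum_boole]
    rfl
  rw [hA]
  calc |∑ t ∈ T with t ∈ A, (p t - q t)| ≤ ∑ t ∈ T with t ∈ A, |p t - q t| :=
        abs_sum_le_sum_abs _ _
    _ ≤ ∑ t ∈ T, |p t - q t| :=
        sum_le_sum_of_subset_of_nonneg (filter_subset _ _) fun _ _ _ => abs_nonneg _
    _ ≤ √(4 * ∑ t ∈ T, p t * log (p t / q t)) :=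
        le_sqrt_of_sq_le (sq_sum_abs_sub_le (fun t _ => by positivity)
          (fun t _ => inv_pos.2 hTpos) hp1 hq1)
    _ = _ := by
        rw [hD, sqrt_mul (by norm_num)]
        congr 1
        rw [show (4 : ℝ) = 2 ^ 2 by norm_num, sqrt_sq (by norm_num)]

end Entropy

end BurgerWords

namespace BurgerWords

/-! ### Counting perfect words as quarter-plane excursions -/

section Counting

/-- The letters other than the fresh order. -/
def plainLetters : Finset Letter :=
  {.burger .ham, .burger .cheese, .order .ham, .order .cheese}

theorem mem_plainLetters {l : Letter} : l ∈ plainLetters ↔ l ≠ .fresh := by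
  rcases l with (_ | _) | (_ | _) | _ <;> simp [plainLetters]

/-- The finite set of the words of length `m` without fresh orders. -/
def plainWordsFinset : ℕ → Finset (List Letter)
  | 0 => {[]}
  | m + 1 => (plainLetters ×ˢ plainWordsFinset m).image fun x => x.1 :: x.2

theorem mem_plainWordsFinset {m : ℕ} {w : List Letter} :
    w ∈ plainWordsFinset m ↔ w ∈ plainWords m := by
  induction m generalizing w with
  | zero =>
    simp only [plainWordsFinset, mem_singleton, plainWords, Set.mem_ofPred_eq,
      List.length_eq_zero_iff]
    constructor
    · rintro rfl; simp
    · exact fun h => h.1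
  | succ m ih =>
    simp only [plainWordsFinset, mem_image, mem_product, mem_plainLetters, ih, plainWords,
      Set.mem_ofPred_eq, Prod.exists]
    constructor
    · rintro ⟨l, v, ⟨hl, hv, hv'⟩, rfl⟩
      simp [hv, hv', Ne.symm hl]
    · rintro ⟨h1, h2⟩
      rcases w with _ | ⟨l, v⟩
      · simp at h1
      · simp only [List.length_cons, Nat.add_right_cancel_iff, List.mem_cons, not_or] at h1 h2
        exact ⟨l, v, ⟨Ne.symm h2.1, h1, h2.2⟩, rfl⟩

theorem sum_plainWordsFinset_succ {M : Type*} [AddCommMonoid M] (m : ℕ) (F : List Letter → M) :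
    ∑ w ∈ plainWordsFinset (m + 1), F w =
      ∑ l ∈ plainLetters, ∑ w ∈ plainWordsFinset m, F (l :: w) := by
  rw [plainWordsFinset, sum_image, sum_product]
  rintro ⟨a, b⟩ _ ⟨c, d⟩ _ h
  simpa using h

theorem card_plainWordsFinset (m : ℕ) : #(plainWordsFinset m) = 4 ^ m := by
  induction m with
  | zero => rfl
  | succ m ih =>
    have := sum_plainWordsFinset_succ m fun _ => 1
    simp only [sum_const, smul_eq_mul, mul_one] at this
    rw [this, ih, pow_succ, mul_comm]
    rfl

/-- The numbers of hamburgers and of cheeseburgers on a stack. -/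
def counts (st : List Burger) : ℕ × ℕ :=
  (st.count .ham, st.count .cheese)

/-- The step of the quarter-plane walk of the burger counts that belongs to a letter; `none` if
the walk would leave the quarter plane. -/
def walkStep : ℕ × ℕ → Letter → Option (ℕ × ℕ)
  | (x, y), .burger .ham => some (x + 1, y)
  | (x, y), .burger .cheese => some (x, y + 1)
  | (x + 1, y), .order .ham => some (x, y)
  | (x, y + 1), .order .cheese => some (x, y)
  | _, _ => none

/-- A typed order is fulfillable exactly when its count is positive, so the arrangement of the stack
is irrelevant without fresh orders. -/
theorem map_counts_step (st : List Burger) {l : Letter} (hl : l ≠ .fresh) :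
    (step st l).map counts = walkStep (counts st) l := by
  rcases l with (_ | _) | (_ | _) | _
  · simp [step, counts, walkStep]
  · simp [step, counts, walkStep]
  · by_cases h : Burger.ham ∈ st
    · obtain ⟨x, hx⟩ := Nat.exists_eq_succ_of_ne_zero (List.count_pos_iff.2 h).ne'
      simp [step, counts, walkStep, h, hx]
    · simp [step, counts, walkStep, h, List.count_eq_zero.2 h]
  · by_cases h : Burger.cheese ∈ st
    · obtain ⟨x, hx⟩ := Nat.exists_eq_succ_of_ne_zero (List.count_pos_iff.2 h).ne'
      simp [step, counts, walkStep, h, hx]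
    · simp [step, counts, walkStep, h, List.count_eq_zero.2 h]
  · exact absurd rfl hl

theorem map_counts_foldlM (st : List Burger) {w : List Letter} (hw : Letter.fresh ∉ w) :
    (w.foldlM step st).map counts = w.foldlM walkStep (counts st) := by
  induction w generalizing st with
  | nil => rfl
  | cons l w ih =>
    simp only [List.mem_cons, not_or] at hw
    rw [List.foldlM_cons, List.foldlM_cons, ← map_counts_step st (Ne.symm hw.1)]
    cases h : step st l with
    | none => rfl
    | some st' => exact ih st' hw.2

theorem counts_eq_zero {st : List Burger} : counts st = (0, 0) ↔ st = [] := by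
  constructor
  · intro h
    simp only [counts, Prod.mk.injEq, List.count_eq_zero] at h
    rcases st with _ | ⟨_ | _, st⟩
    · rfl
    · simp at h
    · simp at h
  · rintro rfl; rfl

theorem mem_theta_zero_iff {n : ℕ} {w : List Letter} :
    w ∈ Theta n 0 ↔ w ∈ plainWords (2 * n) ∧ w.foldlM walkStep (0, 0) = some (0, 0) := by
  simp only [Theta, plainWords, Set.mem_ofPred_eq, List.count_eq_zero]
  have key : Letter.fresh ∉ w → (IsPerfect w ↔ w.foldlM walkStep (0, 0) = some (0, 0)) := by
    intro hw
    have := map_counts_foldlM [] hw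
    rw [show counts [] = (0, 0) from rfl] at this
    rw [← this, IsPerfect, stackAfter, Option.map_eq_some_iff]
    constructor
    · exact fun h => ⟨[], h, rfl⟩
    · rintro ⟨st, h1, h2⟩
      rw [h1, counts_eq_zero.1 h2]
  constructor
  · rintro ⟨h1, h2, h3, -⟩
    exact ⟨⟨h2, h3⟩, (key h3).1 h1⟩
  · rintro ⟨⟨h2, h3⟩, h1⟩
    refine ⟨(key h3).2 h1, h2, h3, ?_⟩
    rintro u v rfl
    simp at h3

/-- The letter with the opposite effect. -/
def Letter.opposite : Letter → Letter
  | .burger b => .order b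
  | .order b => .burger b
  | .fresh => .fresh

theorem Letter.opposite_opposite (l : Letter) : l.opposite.opposite = l := by
  rcases l with _ | _ | _ <;> rfl

theorem walkStep_opposite {p q : ℕ × ℕ} {l : Letter} (h : walkStep p l = some q) :
    walkStep q l.opposite = some p := by
  obtain ⟨x, y⟩ := p
  rcases l with (_ | _) | (_ | _) | _
  · simp only [walkStep, Option.some.injEq] at h
    subst h; rfl
  · simp only [walkStep, Option.some.injEq] at h
    subst h; cases x <;> rfl
  · cases x with
    | zero => simp [walkStep] at h
    | succ x =>
      simp only [walkStep, Option.some.injEq] at h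
      subst h; rfl
  · cases y with
    | zero => simp [walkStep] at h
    | succ y =>
      simp only [walkStep, Option.some.injEq] at h
      subst h; rfl
  · simp [walkStep] at h

theorem foldlM_walkStep_reverse {p q : ℕ × ℕ} {w : List Letter}
    (h : w.foldlM walkStep p = some q) :
    (w.reverse.map Letter.opposite).foldlM walkStep q = some p := by
  induction w generalizing p with
  | nil => simpa [eq_comm] using h
  | cons l w ih =>
    rw [List.foldlM_cons] at h
    cases h' : walkStep p l with
    | none => simp [h'] at h
    | some r =>
      rw [h'] at h
      simp only [List.reverse_cons, List.map_append, List.foldlM_append, ih h, List.map_cons,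
        List.map_nil]
      simp [walkStep_opposite h']

theorem foldlM_walkStep_le {p q : ℕ × ℕ} {w : List Letter} (h : w.foldlM walkStep p = some q) :
    q.1 ≤ p.1 + w.length ∧ q.2 ≤ p.2 + w.length := by
  induction w generalizing p with
  | nil =>
    have : p = q := by simpa using h
    subst this; simp
  | cons l w ih =>
    rw [List.foldlM_cons] at h
    cases h' : walkStep p l with
    | none => simp [h'] at h
    | some r =>
      rw [h'] at h
      have h1 := ih h
      have h2 : r.1 ≤ p.1 + 1 ∧ r.2 ≤ p.2 + 1 := by
        obtain ⟨x, y⟩ := p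
        rcases l with (_ | _) | (_ | _) | _ <;> cases x <;> cases y <;>
          simp [walkStep] at h' <;> subst h' <;> simp <;> omega
      simp only [List.length_cons]
      omega

/-- The discrete harmonic function `(x + 1) * (y + 1)` of the quarter-plane walk. -/
def harmonic : Option (ℕ × ℕ) → ℕ
  | none => 0
  | some p => (p.1 + 1) * (p.2 + 1)

/-- The function is harmonic on the whole lattice and vanishes on the lines `x = -1` and `y = -1`,
where the walk is killed; hence the value 0 at `none`. -/
theorem sum_harmonic_walkStep (p : ℕ × ℕ) :
    ∑ l ∈ plainLetters, harmonic (walkStep p l) = 4 * harmonic (some p) := by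
  obtain ⟨x, y⟩ := p
  rw [plainLetters, sum_insert (by decide), sum_insert (by decide), sum_insert (by decide),
    sum_singleton]
  cases x <;> cases y <;> simp [walkStep, harmonic] <;> ring

theorem sum_harmonic_foldlM (m : ℕ) (p : ℕ × ℕ) :
    ∑ w ∈ plainWordsFinset m, harmonic (w.foldlM walkStep p) = 4 ^ m * harmonic (some p) := by
  induction m generalizing p with
  | zero => simp [plainWordsFinset]
  | succ m ih =>
    rw [sum_plainWordsFinset_succ, pow_succ, mul_assoc, ← sum_harmonic_walkStep, mul_sum]
    refine sum_congr rfl fun l _ => ?_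
    cases h : walkStep p l with
    | none => simp [h, harmonic]
    | some q => simp [h, ih]

/-- The finite set of the perfect words of order `n` without fresh orders. -/
noncomputable def thetaFinset (n : ℕ) : Finset (List Letter) :=
  (theta_finite n 0).toFinset

theorem mem_thetaFinset {n : ℕ} {w : List Letter} :
    w ∈ thetaFinset n ↔ w ∈ plainWords (2 * n) ∧ w.foldlM walkStep (0, 0) = some (0, 0) := by
  rw [thetaFinset, Set.Finite.mem_toFinset, mem_theta_zero_iff]

/-- The words of length `n` whose walk ends at `q`. -/
def walksTo (n : ℕ) (q : ℕ × ℕ) : Finset (List Letter) :=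
  {w ∈ plainWordsFinset n | w.foldlM walkStep (0, 0) = some q}

/-- A walk to `q` followed by the reversal of another walk to `q` is an excursion of length `2 * n`.
Cutting it at time `n` recovers both halves and `q`. -/
theorem sum_sq_card_walksTo_le (n : ℕ) (B : Finset (ℕ × ℕ)) :
    ∑ q ∈ B, #(walksTo n q) ^ 2 ≤ #(thetaFinset n) := by
  have h : #(B.sigma fun q => walksTo n q ×ˢ walksTo n q) = ∑ q ∈ B, #(walksTo n q) ^ 2 := by
    simp [card_sigma, sq]
  rw [← h]
  refine card_le_card_of_injOn (fun x => x.2.1 ++ x.2.2.reverse.map Letter.opposite) ?_ ?_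
  · rintro ⟨q, u, v⟩ hx
    simp only [coe_sigma, Set.mem_sigma_iff, mem_coe, mem_product, walksTo, mem_filter,
      mem_plainWordsFinset, plainWords, Set.mem_ofPred_eq] at hx
    obtain ⟨-, ⟨⟨hu1, hu2⟩, hu3⟩, ⟨hv1, hv2⟩, hv3⟩ := hx
    simp only [mem_coe, mem_thetaFinset, plainWords, Set.mem_ofPred_eq]
    refine ⟨⟨by simp [hu1, hv1, two_mul], ?_⟩, ?_⟩
    · simp only [List.mem_append, List.mem_map, List.mem_reverse, not_or, not_exists, not_and]
      refine ⟨hu2, fun l hl h => ?_⟩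
      rw [← l.opposite_opposite, h] at hl
      exact hv2 hl
    · rw [List.foldlM_append, hu3]
      exact foldlM_walkStep_reverse hv3
  · rintro ⟨q, u, v⟩ hx ⟨q', u', v'⟩ hx' heq
    simp only [coe_sigma, Set.mem_sigma_iff, mem_coe, mem_product, walksTo, mem_filter,
      mem_plainWordsFinset, plainWords, Set.mem_ofPred_eq] at hx hx'
    obtain ⟨h1, h2⟩ := List.append_inj heq (hx.2.1.1.1.trans hx'.2.1.1.1.symm)
    simp only at h1 h2
    have h3 := List.reverse_injective
      (List.map_injective_iff.2 (Function.LeftInverse.injective Letter.opposite_opposite) h2)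
    subst h1 h3
    have : some q = some q' := hx.2.1.2.symm.trans hx'.2.1.2
    simp only [Option.some.injEq] at this
    subst this
    rfl

/-- Perfect words without fresh orders make up a polynomial fraction of all words. -/
theorem sixteen_pow_le (n : ℕ) : 16 ^ n ≤ (n + 1) ^ 6 * #(thetaFinset n) := by
  set B : Finset (ℕ × ℕ) := range (n + 1) ×ˢ range (n + 1) with hB
  -- Conservation of the harmonic weight from the origin, grouped by endpoint. Killed walks have
  -- weight 0, so the default `(0, 0)` of `getD` is never used.
  have h1 : ∑ q ∈ B, #(walksTo n q) * harmonic (some q) = 4 ^ n := by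
    have := sum_harmonic_foldlM n (0, 0)
    rw [show harmonic (some (0, 0)) = 1 from rfl, mul_one] at this
    rw [← this, ← sum_filter_add_sum_filter_not _
      (fun w : List Letter => (w.foldlM walkStep (0, 0)).isSome)]
    have hz : ∑ w ∈ plainWordsFinset n with ¬ (w.foldlM walkStep (0, 0)).isSome = true,
        harmonic (w.foldlM walkStep (0, 0)) = 0 := by
      refine sum_eq_zero fun w hw => ?_
      rw [mem_filter, Option.not_isSome_iff_eq_none] at hw
      rw [hw.2]; rfl
    have hmaps : ∀ w ∈ plainWordsFinset n, ∀ q, w.foldlM walkStep (0, 0) = some q → q ∈ B := by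
      intro w hw q hq
      have h := foldlM_walkStep_le hq
      have h' := (mem_plainWordsFinset.1 hw).1
      simp only [hB, mem_product, mem_range]
      simp only [h'] at h
      omega
    have hmaps' : ∀ w ∈ {w ∈ plainWordsFinset n | (w.foldlM walkStep (0, 0)).isSome = true},
        (w.foldlM walkStep (0, 0)).getD (0, 0) ∈ B := by
      intro w hw
      rw [mem_filter, Option.isSome_iff_exists] at hw
      obtain ⟨hw, q, hq⟩ := hw
      rw [hq]
      exact hmaps w hw q hq
    rw [hz, add_zero, ← sum_fiberwise_of_maps_to hmaps']
    refine sum_congr rfl fun q hq => ?_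
    rw [filter_filter]
    have hf : {w ∈ plainWordsFinset n | (w.foldlM walkStep (0, 0)).isSome = true ∧
        (w.foldlM walkStep (0, 0)).getD (0, 0) = q} = walksTo n q := by
      refine filter_congr fun w _ => ?_
      cases w.foldlM walkStep (0, 0) <;> simp
    rw [hf, sum_congr rfl (g := fun _ => harmonic (some q)) fun w hw => by
      rw [(mem_filter.1 hw).2], sum_const, smul_eq_mul]
  -- There are `(n + 1) ^ 2` endpoints, each with squared weight at most `(n + 1) ^ 4`.
  have h2 : ∑ q ∈ B, harmonic (some q) ^ 2 ≤ (n + 1) ^ 6 := by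
    calc ∑ q ∈ B, harmonic (some q) ^ 2 ≤ ∑ q ∈ B, ((n + 1) * (n + 1)) ^ 2 := by
          refine sum_le_sum fun q hq => ?_
          simp only [hB, mem_product, mem_range] at hq
          exact Nat.pow_le_pow_left (Nat.mul_le_mul hq.1 hq.2) 2
      _ = (n + 1) ^ 6 := by
          rw [sum_const, hB, card_product, card_range, smul_eq_mul]
          ring
  calc 16 ^ n = (∑ q ∈ B, #(walksTo n q) * harmonic (some q)) ^ 2 := by
        rw [h1, ← pow_mul, mul_comm n 2, pow_mul]
        norm_num
    _ ≤ (∑ q ∈ B, #(walksTo n q) ^ 2) * ∑ q ∈ B, harmonic (some q) ^ 2 :=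
        sum_mul_sq_le_sq_mul_sq _ _ _
    _ ≤ #(thetaFinset n) * (n + 1) ^ 6 := Nat.mul_le_mul (sum_sq_card_walksTo_le n B) h2
    _ = _ := mul_comm _ _

end Counting

end BurgerWords

namespace BurgerWords

/-! ### Entropy defects of the letters of a perfect word -/

section WordEntropy

/-- The letters of `W` at the positions in `U`, counted from `0`. -/
def restrict (U : Finset ℕ) (W : List Letter) : ℕ → Option Letter :=
  fun u => if u ∈ U then W[u]? else none

theorem restrict_eq_iff {U : Finset ℕ} {W W' : List Letter} :
    restrict U W = restrict U W' ↔ ∀ u ∈ U, W[u]? = W'[u]? := by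
  constructor
  · intro h u hu
    simpa [restrict, hu] using congrFun h u
  · intro h
    funext u
    by_cases hu : u ∈ U <;> simp [restrict, hu, h]

theorem thetaFinset_nonempty (n : ℕ) : (thetaFinset n).Nonempty :=
  (theta_finite n 0).toFinset_nonempty.2 (theta_zero_nonempty n)

/-- The conditional entropy that the letter at position `u` of a uniform perfect word of order `n`
lacks, given the earlier letters. -/
noncomputable def entropyDefect (n u : ℕ) : ℝ :=
  log 4 - (meanLogFiber (thetaFinset n) (restrict (range u)) -
    meanLogFiber (thetaFinset n) (restrict (range (u + 1))))

theorem meanLogFiber_restrict_insert (Ω : Finset (List Letter)) (U : Finset ℕ) (u : ℕ) :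
    meanLogFiber Ω (restrict (insert u U)) =
      meanLogFiber Ω (fun W => (W[u]?, restrict U W)) := by
  refine meanLogFiber_congr fun W _ W' _ => ?_
  simp only [Prod.mk.injEq, restrict_eq_iff, mem_insert, forall_eq_or_imp]

theorem meanLogFiber_restrict_empty (n : ℕ) :
    meanLogFiber (thetaFinset n) (restrict ∅) = log #(thetaFinset n) := by
  have h : (#(thetaFinset n) : ℝ) ≠ 0 := by
    exact_mod_cast (card_pos.2 (thetaFinset_nonempty n)).ne'
  have : ∀ W, fiberCard (thetaFinset n) (restrict ∅) W = #(thetaFinset n) := by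
    intro W
    simp [fiberCard, restrict_eq_iff]
  simp only [meanLogFiber, this, sum_const, nsmul_eq_mul]
  field_simp

theorem meanLogFiber_restrict_range (n : ℕ) :
    meanLogFiber (thetaFinset n) (restrict (range (2 * n))) = 0 := by
  have : ∀ W ∈ thetaFinset n, fiberCard (thetaFinset n) (restrict (range (2 * n))) W = 1 := by
    classical
    intro W hW
    have hl := (mem_thetaFinset.1 hW).1.1
    unfold fiberCard
    norm_cast
    rw [card_eq_one]
    refine ⟨W, ?_⟩
    ext W'
    simp only [mem_filter, mem_singleton, restrict_eq_iff, mem_range]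
    constructor
    · rintro ⟨hW', h⟩
      have hl' := (mem_thetaFinset.1 hW').1.1
      refine List.ext_getElem? fun u => ?_
      by_cases hu : u < 2 * n
      · exact h u hu
      · rw [List.getElem?_eq_none (by omega), List.getElem?_eq_none (by omega)]
    · rintro rfl
      exact ⟨hW, fun _ _ => rfl⟩
  unfold meanLogFiber
  rw [sum_congr rfl fun W hW => by rw [this W hW, log_one]]
  simp

/-- A letter takes only four values, so its conditional entropy is at most `log 4`. -/
theorem entropyDefect_nonneg {n u : ℕ} (hu : u < 2 * n) : 0 ≤ entropyDefect n u := by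
  unfold entropyDefect
  rw [range_add_one, meanLogFiber_restrict_insert, sub_nonneg]
  have := meanLogFiber_sub_le_log_card (Ω := thetaFinset n) (fun W => W[u]?)
    (restrict (range u)) (plainLetters.image some) (fun W hW => ?_) (thetaFinset_nonempty n)
  · refine this.trans (le_of_eq ?_)
    rw [card_image_of_injective _ (Option.some_injective _)]
    rw [show #plainLetters = 4 from rfl]
    norm_num
  · obtain ⟨h1, h2⟩ := (mem_thetaFinset.1 hW).1
    rw [mem_image]
    refine ⟨W[u]'(by omega), mem_plainLetters.2 fun h => h2 (h ▸ List.getElem_mem _), ?_⟩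
    rw [List.getElem?_eq_getElem]

/-- The chain rule telescopes the sum to `2 * n * log 4 - log #(thetaFinset n)`, which the counting
bound controls. -/
theorem sum_entropyDefect_le (n : ℕ) :
    ∑ u ∈ range (2 * n), entropyDefect n u ≤ 6 * log (n + 1) := by
  have hpos : (0 : ℝ) < #(thetaFinset n) := by
    exact_mod_cast card_pos.2 (thetaFinset_nonempty n)
  have h1 : ∑ u ∈ range (2 * n), entropyDefect n u =
      n * log 16 - log #(thetaFinset n) := by
    unfold entropyDefect
    rw [sum_sub_distrib, sum_range_sub', range_zero, meanLogFiber_restrict_empty,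
      meanLogFiber_restrict_range, sum_const, card_range, nsmul_eq_mul,
      show (16 : ℝ) = 4 ^ 2 by norm_num, log_pow]
    push_cast
    ring
  have h2 : (16 : ℝ) ^ n ≤ (n + 1) ^ 6 * #(thetaFinset n) := by exact_mod_cast sixteen_pow_le n
  have h3 := log_le_log (by positivity) h2
  rw [log_pow, log_mul (by positivity) hpos.ne', log_pow] at h3
  push_cast at h3
  linarith

/-- Positions are added in increasing order. The new letter is then conditioned only on the earlier
letters in `U`, so its entropy is at least that given the entire past. -/
theorem card_mul_log_add_meanLogFiber_le (n : ℕ) (U : Finset ℕ) :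
    #U * log 4 - log #(thetaFinset n) + meanLogFiber (thetaFinset n) (restrict U) ≤
      ∑ u ∈ U, entropyDefect n u := by
  induction U using Finset.induction_on_max with
  | empty => simp [meanLogFiber_restrict_empty]
  | insert u U hU ih =>
    have hu : u ∉ U := fun h => lt_irrefl _ (hU u h)
    rw [sum_insert hu, card_insert_of_notMem hu]
    have h := meanLogFiber_sub_le_of_finer (Ω := thetaFinset n) (fun W => W[u]?)
      (g := restrict U) (h := restrict (range u)) fun W _ W' _ hW => by
        rw [restrict_eq_iff] at hW ⊢
        exact fun v hv => hW v (mem_range.2 (hU v hv))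
    rw [← meanLogFiber_restrict_insert, ← meanLogFiber_restrict_insert, ← range_add_one] at h
    have hd : entropyDefect n u = log 4 - (meanLogFiber (thetaFinset n) (restrict (range u)) -
      meanLogFiber (thetaFinset n) (restrict (range (u + 1)))) := rfl
    push_cast
    linarith

end WordEntropy

end BurgerWords

namespace BurgerWords

/-! ### Averages over random index tuples -/

section Indices

/-- Double counting: each point lies in equally many `k`-subsets. Avoiding division keeps the
degenerate cases true. -/
theorem card_mul_sum_powersetCard_sum (T : Finset ℕ) (k : ℕ) (g : ℕ → ℝ) :
    #T * ∑ S ∈ powersetCard k T, ∑ v ∈ S, g v = k * #(powersetCard k T) * ∑ v ∈ T, g v := by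
  rcases k with _ | k
  · simp
  have h1 : ∑ S ∈ powersetCard (k + 1) T, ∑ v ∈ S, g v
      = ∑ v ∈ T, (#T - 1).choose k * g v := by
    rw [sum_comm' (t' := T) (s' := fun v => {S ∈ powersetCard (k + 1) T | {v} ⊆ S})]
    · refine sum_congr rfl fun v hv => ?_
      rw [sum_const, nsmul_eq_mul, card_filter_powersetCard_subset _ _ _ (by simpa using hv)
        (by simp)]
      simp
    · intro S v
      simp only [mem_powersetCard, mem_filter, singleton_subset_iff]
      constructor
      · rintro ⟨h, hv⟩
        exact ⟨⟨h, hv⟩, h.1 hv⟩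
      · exact fun h => h.1
  rw [h1, ← mul_sum, ← mul_assoc, card_powersetCard]
  congr 1
  rcases h : #T with _ | N
  · simp
  · rw [Nat.add_sub_cancel]
    have := Nat.add_one_mul_choose_eq N k
    rw [mul_comm (((k + 1 : ℕ) : ℝ))]
    exact_mod_cast this

/-- The analogue for ordered pairs of distinct points, each of which lies in equally many
`k`-subsets. -/
theorem card_mul_sum_powersetCard_sum_offDiag (T : Finset ℕ) (k : ℕ) (g : ℕ × ℕ → ℝ) :
    #T * (#T - 1) * ∑ S ∈ powersetCard k T, ∑ p ∈ S.offDiag, g p =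
      k * (k - 1) * #(powersetCard k T) * ∑ p ∈ T.offDiag, g p := by
  rcases k with _ | _ | k
  · simp
  · rw [sum_eq_zero fun S hS => ?_]
    · simp
    · obtain ⟨v, rfl⟩ := card_eq_one.1 (mem_powersetCard.1 hS).2
      simp
  have h1 : ∑ S ∈ powersetCard (k + 2) T, ∑ p ∈ S.offDiag, g p
      = ∑ p ∈ T.offDiag, (#T - 2).choose k * g p := by
    rw [sum_comm' (t' := T.offDiag)
      (s' := fun p => {S ∈ powersetCard (k + 2) T | {p.1, p.2} ⊆ S})]
    · refine sum_congr rfl fun p hp => ?_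
      rw [mem_offDiag] at hp
      rw [sum_const, nsmul_eq_mul, card_filter_powersetCard_subset _ _ _
        (by simp [insert_subset_iff, hp.1, hp.2.1]) (by simp [card_pair hp.2.2])]
      simp [card_pair hp.2.2]
    · intro S p
      simp only [mem_powersetCard, mem_filter, mem_offDiag, insert_subset_iff,
        singleton_subset_iff]
      constructor
      · rintro ⟨h, h1, h2, h3⟩
        exact ⟨⟨h, h1, h2⟩, h.1 h1, h.1 h2, h3⟩
      · rintro ⟨⟨h, h1, h2⟩, -, -, h3⟩
        exact ⟨h, h1, h2, h3⟩
  rw [h1, ← mul_sum, ← mul_assoc, card_powersetCard]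
  congr 1
  rcases h : #T with _ | _ | N
  · simp
  · simp [Nat.choose_eq_zero_of_lt]
  · have e1 := Nat.add_one_mul_choose_eq (N + 1) (k + 1)
    have e2 := Nat.add_one_mul_choose_eq N k
    rw [show N + 1 + 1 - 2 = N by omega]
    have e1' : ((N : ℝ) + 1 + 1) * ((N + 1).choose (k + 1)) =
      ((N + 1 + 1).choose (k + 1 + 1)) * (k + 1 + 1) := by exact_mod_cast e1
    have e2' : ((N : ℝ) + 1) * (N.choose k) = ((N + 1).choose (k + 1)) * (k + 1) := by
      exact_mod_cast e2
    push_cast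
    linear_combination (k + 1 : ℝ) * e1' + (N + 1 + 1 : ℝ) * e2'

/-- The finite set of the increasing index tuples. -/
noncomputable def indexFinset (n k : ℕ) : Finset (Fin k → ℕ) :=
  (indexTuples_finite n k).toFinset

theorem mem_indexFinset {n k : ℕ} {i : Fin k → ℕ} :
    i ∈ indexFinset n k ↔ StrictMono i ∧ ∀ j, i j ∈ Icc 1 (2 * n) := by
  simp [indexFinset, indexTuples]

theorem sum_indexFinset {n k : ℕ} (F : Finset ℕ → ℝ) :
    ∑ i ∈ indexFinset n k, F (univ.image i) = ∑ S ∈ powersetCard k (Icc 1 (2 * n)), F S := by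
  refine sum_nbij (fun i => univ.image i) ?_ ?_ ?_ fun _ _ => rfl
  · intro i hi
    rw [mem_indexFinset] at hi
    rw [mem_powersetCard, card_image_of_injective _ hi.1.injective, card_univ, Fintype.card_fin]
    refine ⟨?_, rfl⟩
    intro v hv
    obtain ⟨j, -, rfl⟩ := mem_image.1 hv
    exact hi.2 j
  · intro i hi i' hi' h
    rw [mem_coe, mem_indexFinset] at hi hi'
    refine (StrictMono.range_inj hi.1 hi'.1).1 ?_
    have := congrArg (fun S : Finset ℕ => (S : Set ℕ)) h
    simpa using this
  · intro S hS
    rw [mem_coe, mem_powersetCard] at hS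
    refine ⟨S.orderEmbOfFin hS.2, ?_, ?_⟩
    · rw [mem_coe, mem_indexFinset]
      exact ⟨(S.orderEmbOfFin hS.2).strictMono, fun j => hS.1 (orderEmbOfFin_mem S hS.2 j)⟩
    · apply coe_injective
      simp

theorem card_indexFinset (n k : ℕ) :
    (#(indexFinset n k) : ℝ) = #(powersetCard k (Icc 1 (2 * n))) := by
  have := sum_indexFinset (n := n) (k := k) fun _ => 1
  simpa using this

theorem sum_indexFinset_sum (n k : ℕ) (g : ℕ → ℝ) :
    (2 * n : ℝ) * ∑ i ∈ indexFinset n k, ∑ j, g (i j) =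
      k * #(indexFinset n k) * ∑ v ∈ Icc 1 (2 * n), g v := by
  have h := card_mul_sum_powersetCard_sum (Icc 1 (2 * n)) k g
  rw [← sum_indexFinset fun S => ∑ v ∈ S, g v, ← card_indexFinset] at h
  rw [← h, Nat.card_Icc, Nat.add_sub_cancel]
  push_cast
  congr 1
  refine sum_congr rfl fun i hi => ?_
  rw [sum_image (mem_indexFinset.1 hi).1.injective.injOn]

open Classical in
theorem card_filter_lt_le (n k s : ℕ) :
    (n : ℝ) * #{i ∈ indexFinset n k | ∃ j, i j < s} ≤ k * s * #(indexFinset n k) := by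
  have h1 : (#{i ∈ indexFinset n k | ∃ j, i j < s} : ℝ) ≤
      ∑ i ∈ indexFinset n k, ∑ j, if i j < s then (1 : ℝ) else 0 := by
    rw [← sum_boole]
    refine sum_le_sum fun i _ => ?_
    split_ifs with h
    · obtain ⟨j, hj⟩ := h
      refine le_trans (by simp [hj]) (single_le_sum (fun j _ => ?_) (mem_univ j))
      positivity
    · positivity
  have h2 : ∑ v ∈ Icc 1 (2 * n), (if v < s then (1 : ℝ) else 0) ≤ s := by
    rw [sum_boole]
    calc (#{v ∈ Icc 1 (2 * n) | v < s} : ℝ) ≤ #(range s) := by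
          exact_mod_cast card_le_card fun v hv => mem_range.2 (mem_filter.1 hv).2
      _ = s := by simp
  have h3 := sum_indexFinset_sum n k fun v => if v < s then (1 : ℝ) else 0
  have h4 := mul_le_mul_of_nonneg_left h2 (by positivity : (0 : ℝ) ≤ k * #(indexFinset n k))
  have h5 := mul_le_mul_of_nonneg_left h1 (by positivity : (0 : ℝ) ≤ 2 * n)
  have h6 : (0 : ℝ) ≤ n * #{i ∈ indexFinset n k | ∃ j, i j < s} := by positivity
  linarith

theorem lt_add_of_not_disjoint {s a b : ℕ}
    (h : ¬ Disjoint (Icc (firstPos s a) a) (Icc (firstPos s b) b)) : b < a + s := by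
  rw [not_disjoint_iff] at h
  obtain ⟨x, hx, hx'⟩ := h
  rw [mem_Icc] at hx hx'
  have : b + 1 - s ≤ firstPos s b := le_max_left _ _
  omega

open Classical in
theorem card_filter_overlap_le (n k s : ℕ) :
    (n : ℝ) * #{i ∈ indexFinset n k | ¬ Nonoverlapping s i} ≤ k ^ 2 * s * #(indexFinset n k) := by
  rcases Nat.eq_zero_or_pos n with rfl | hn
  · simp only [CharP.cast_eq_zero, zero_mul]; positivity
  -- Two windows can meet only if their endpoints are less than `s` apart. Orienting the pair by
  -- `p.1 < p.2` counts it once.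
  set g : ℕ × ℕ → ℝ := fun p => if p.1 < p.2 ∧ p.2 < p.1 + s then 1 else 0 with hg
  have hg0 : ∀ p, 0 ≤ g p := fun p => by simp only [hg]; positivity
  have h1 : (#{i ∈ indexFinset n k | ¬ Nonoverlapping s i} : ℝ) ≤
      ∑ i ∈ indexFinset n k, ∑ p ∈ (univ.image i).offDiag, g p := by
    rw [← sum_boole]
    refine sum_le_sum fun i hi => ?_
    have hinj := (mem_indexFinset.1 hi).1.injective
    by_cases h : ¬ Nonoverlapping s i
    · rw [if_pos h]
      simp only [Nonoverlapping, Pairwise, not_forall] at h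
      obtain ⟨a, b, hab, h⟩ := h
      have key : ∃ p ∈ (univ.image i).offDiag, g p = 1 := by
        rcases lt_or_gt_of_ne (hinj.ne hab) with hlt | hlt
        · exact ⟨(i a, i b), by simp [hlt.ne], by simp [hg, hlt, lt_add_of_not_disjoint h]⟩
        · rw [disjoint_comm] at h
          exact ⟨(i b, i a), by simp [hlt.ne], by simp [hg, hlt, lt_add_of_not_disjoint h]⟩
      obtain ⟨p, hp, hp1⟩ := key
      rw [← hp1]
      exact single_le_sum (fun p _ => hg0 p) hp
    · rw [if_neg h]
      exact sum_nonneg fun p _ => hg0 p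
  rw [sum_indexFinset fun S => ∑ p ∈ S.offDiag, g p] at h1
  have h2 : ∑ p ∈ (Icc 1 (2 * n)).offDiag, g p ≤ 2 * n * s := by
    calc ∑ p ∈ (Icc 1 (2 * n)).offDiag, g p ≤ ∑ p ∈ Icc 1 (2 * n) ×ˢ Icc 1 (2 * n), g p :=
          sum_le_sum_of_subset_of_nonneg (fun p hp => by
            rw [mem_offDiag] at hp
            exact mem_product.2 ⟨hp.1, hp.2.1⟩) fun p _ _ => hg0 p
      _ ≤ ∑ v ∈ Icc 1 (2 * n), (s : ℝ) := by
          rw [sum_product]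
          refine sum_le_sum fun v _ => ?_
          simp only [hg]
          rw [sum_boole]
          calc (#{w ∈ Icc 1 (2 * n) | v < w ∧ w < v + s} : ℝ) ≤ #(Ico v (v + s)) := by
                exact_mod_cast card_le_card fun w hw => by
                  rw [mem_filter] at hw
                  exact mem_Ico.2 ⟨hw.2.1.le, hw.2.2⟩
            _ = s := by simp
      _ = 2 * n * s := by simp
  have h3 := card_mul_sum_powersetCard_sum_offDiag (Icc 1 (2 * n)) k g
  rw [← card_indexFinset, Nat.card_Icc, Nat.add_sub_cancel] at h3
  push_cast at h3
  have hn1 : (1 : ℝ) ≤ n := by exact_mod_cast hn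
  have hk : (0 : ℝ) ≤ k * (k - 1) := by
    rcases Nat.eq_zero_or_pos k with rfl | hk
    · simp
    · have : (1 : ℝ) ≤ k := by exact_mod_cast hk
      exact mul_nonneg (by positivity) (by linarith)
  set X : ℝ := ((#{i ∈ indexFinset n k | ¬ Nonoverlapping s i} : ℕ) : ℝ)
  set M : ℝ := ((#(indexFinset n k) : ℕ) : ℝ)
  have hM : 0 ≤ M := Nat.cast_nonneg _
  have hX : 0 ≤ X := Nat.cast_nonneg _
  have h4 : (2 * n : ℝ) * ((2 * n - 1) * X) ≤ 2 * n * (k ^ 2 * s * M) := by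
    calc (2 * n : ℝ) * ((2 * n - 1) * X) ≤
          2 * n * (2 * n - 1) * ∑ S ∈ powersetCard k (Icc 1 (2 * n)), ∑ p ∈ S.offDiag, g p := by
          rw [← mul_assoc]
          exact mul_le_mul_of_nonneg_left h1 (mul_nonneg (by positivity) (by linarith))
      _ = k * (k - 1) * M * ∑ p ∈ (Icc 1 (2 * n)).offDiag, g p := h3
      _ ≤ k * (k - 1) * M * (2 * n * s) :=
          mul_le_mul_of_nonneg_left h2 (mul_nonneg hk hM)
      _ ≤ k ^ 2 * M * (2 * n * s) := by
          refine mul_le_mul_of_nonneg_right (mul_le_mul_of_nonneg_right ?_ hM) (by positivity)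
          nlinarith [(Nat.cast_nonneg k : (0 : ℝ) ≤ k)]
      _ = _ := by ring
  have h5 := le_of_mul_le_mul_left h4 (by positivity)
  -- Here `n ≤ 2 * n - 1`, because `n` is positive.
  refine le_trans (mul_le_mul_of_nonneg_right ?_ hX) h5
  linarith

/-- A position `u` lies in the window of an endpoint `v` only if `u < v ≤ u + s`, so it is covered
by at most `s` endpoints. -/
theorem sum_window_entropyDefect_le (n k s : ℕ) :
    (2 * n : ℝ) * ∑ i ∈ indexFinset n k, ∑ j, ∑ u ∈ Ico (i j - s) (i j), entropyDefect n u ≤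
      k * #(indexFinset n k) * (s * ∑ u ∈ range (2 * n), entropyDefect n u) := by
  rw [sum_indexFinset_sum n k fun v => ∑ u ∈ Ico (v - s) v, entropyDefect n u]
  refine mul_le_mul_of_nonneg_left ?_ (by positivity)
  rw [sum_comm' (t' := range (2 * n)) (s' := fun u => {v ∈ Icc 1 (2 * n) | u ∈ Ico (v - s) v}),
    mul_sum]
  · refine sum_le_sum fun u hu => ?_
    rw [sum_const, nsmul_eq_mul]
    refine mul_le_mul_of_nonneg_right ?_ (entropyDefect_nonneg (mem_range.1 hu))
    calc (#{v ∈ Icc 1 (2 * n) | u ∈ Ico (v - s) v} : ℝ) ≤ #(Ioc u (u + s)) := by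
          exact_mod_cast card_le_card fun v hv => by
            simp only [mem_filter, mem_Icc, mem_Ico, mem_Ioc] at hv ⊢
            omega
      _ = s := by simp
  · intro v u
    simp only [mem_filter, mem_Icc, mem_Ico, mem_range]
    omega

end Indices

end BurgerWords

namespace BurgerWords

/-! ### From entropy to total variation distance -/

section Laws

open Classical in
theorem prob_uniform {α : Type*} (S : Set α) (hf : S.Finite) (hne : S.Nonempty) (A : Set α) :
    prob (uniform S hf hne) A = (#{x ∈ hf.toFinset | x ∈ A} : ℝ) / #hf.toFinset := by
  simp [prob, uniform, PMF.toOuterMeasure_uniformOfFinset_apply]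

theorem toOuterMeasure_ne_top {α : Type*} (p : PMF α) (A : Set α) : p.toOuterMeasure A ≠ ⊤ := by
  have h : p.toOuterMeasure Set.univ = 1 :=
    (PMF.toOuterMeasure_apply_eq_one_iff p _).2 (Set.subset_univ _)
  refine ((MeasureTheory.measure_mono (Set.subset_univ A)).trans_lt ?_).ne
  rw [h]
  exact ENNReal.one_lt_top

theorem prob_indep_uniform {α β : Type*} (S : Set α) (hf : S.Finite) (hne : S.Nonempty)
    (q : PMF β) (A : Set (α × β)) :
    prob (indep (uniform S hf hne) q) A =
      (∑ a ∈ hf.toFinset, prob q {b | (a, b) ∈ A}) / #hf.toFinset := by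
  unfold prob indep
  rw [PMF.toOuterMeasure_bind_apply, tsum_eq_sum (s := hf.toFinset), ENNReal.toReal_sum, sum_div]
  · refine sum_congr rfl fun a ha => ?_
    rw [uniform, PMF.uniformOfFinset_apply_of_mem _ ha, PMF.toOuterMeasure_map_apply,
      ENNReal.toReal_mul, ENNReal.toReal_inv, ENNReal.toReal_natCast, div_eq_mul_inv, mul_comm]
    rfl
  · intro a _
    exact ENNReal.mul_ne_top (PMF.apply_ne_top _ _) (toOuterMeasure_ne_top _ _)
  · intro a ha
    rw [uniform, PMF.uniformOfFinset_apply_of_notMem _ ha, zero_mul]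

theorem prob_map {α β : Type*} (p : PMF α) (f : α → β) (A : Set β) :
    prob (p.map f) A = prob p (f ⁻¹' A) := by
  rw [prob, PMF.toOuterMeasure_map_apply, prob]

theorem indexFinset_nonempty {n k : ℕ} (hk : k ≤ 2 * n) : (indexFinset n k).Nonempty :=
  (indexTuples_finite n k).toFinset_nonempty.2 (indexTuples_nonempty hk)

-- Independence permits fixing the index tuple first, so that the two laws can be compared tuple by
-- tuple.
open Classical in
theorem prob_sample {n k : ℕ} (hk : k ≤ 2 * n) (A : Set (List Letter × (Fin k → ℕ))) :
    prob (sample n k hk) A =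
      (∑ i ∈ indexFinset n k, (#{W ∈ thetaFinset n | (W, i) ∈ A} : ℝ) / #(thetaFinset n)) /
        #(indexFinset n k) := by
  rw [sample, prob_indep_uniform]
  simp only [prob_uniform, Set.mem_ofPred_eq]
  change (∑ W ∈ thetaFinset n, (#{i ∈ indexFinset n k | (W, i) ∈ A} : ℝ) / #(indexFinset n k)) /
    #(thetaFinset n) = _
  rw [← sum_div, ← sum_div, div_right_comm]
  simp only [← sum_boole]
  rw [sum_comm]

open Classical in
theorem prob_sample_snd {n k : ℕ} (hk : k ≤ 2 * n) (P : (Fin k → ℕ) → Prop) :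
    prob (sample n k hk) {x | P x.2} =
      (#{i ∈ indexFinset n k | P i} : ℝ) / #(indexFinset n k) := by
  have hpos : (#(thetaFinset n) : ℝ) ≠ 0 := by
    exact_mod_cast (card_pos.2 (thetaFinset_nonempty n)).ne'
  rw [prob_sample, ← sum_boole]
  congr 1
  refine sum_congr rfl fun i _ => ?_
  by_cases h : P i <;> simp [h, hpos]

/-- The finite set of the `k`-tuples of words of length `s` without fresh orders. -/
def plainTuplesFinset (k s : ℕ) : Finset (Fin k → List Letter) :=
  Fintype.piFinset fun _ => plainWordsFinset s

theorem card_plainTuplesFinset (k s : ℕ) : #(plainTuplesFinset k s) = 4 ^ (k * s) := by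
  rw [plainTuplesFinset, Fintype.card_piFinset, prod_const, card_plainWordsFinset, card_univ,
    Fintype.card_fin, ← pow_mul, mul_comm]

open Classical in
theorem prob_idealLaw {n k s : ℕ} (hk : k ≤ 2 * n)
    (A : Set ((Fin k → ℕ) × (Fin k → List Letter))) :
    prob (idealLaw n k s hk) A =
      (∑ i ∈ indexFinset n k, (#{v ∈ plainTuplesFinset k s | (i, v) ∈ A} : ℝ) /
        #(plainTuplesFinset k s)) / #(indexFinset n k) := by
  have h : (plainTuples_finite k s).toFinset = plainTuplesFinset k s := by
    ext v
    simp [plainTuplesFinset, mem_plainWordsFinset]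
  rw [idealLaw, prob_indep_uniform]
  simp only [iidWords, prob_uniform, Set.mem_ofPred_eq, h]
  rfl

open Classical in
theorem prob_subwordLaw {n k s : ℕ} (hk : k ≤ 2 * n)
    (A : Set ((Fin k → ℕ) × (Fin k → List Letter))) :
    prob (subwordLaw n k s hk) A =
      (∑ i ∈ indexFinset n k, (#{W ∈ thetaFinset n | (i, subwords s W i) ∈ A} : ℝ) /
        #(thetaFinset n)) / #(indexFinset n k) := by
  rw [subwordLaw, prob_map, prob_sample]
  rfl

/-- The subwords are nonoverlapping and none of them is cut off at the front. -/
def Good {k : ℕ} (s : ℕ) (i : Fin k → ℕ) : Prop :=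
  Nonoverlapping s i ∧ ∀ j, s ≤ i j

theorem subword_firstPos {s i : ℕ} (h : s ≤ i) (W : List Letter) :
    subword W (firstPos s i) i = (W.take i).drop (i - s) := by
  rw [subword, show firstPos s i - 1 = i - s by unfold firstPos; omega]

theorem subwords_mem {n k s : ℕ} {i : Fin k → ℕ} (hi : i ∈ indexFinset n k) (hg : Good s i)
    {W : List Letter} (hW : W ∈ thetaFinset n) : subwords s W i ∈ plainTuplesFinset k s := by
  obtain ⟨h1, h2⟩ := (mem_thetaFinset.1 hW).1
  rw [plainTuplesFinset, Fintype.mem_piFinset]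
  intro j
  have hj := mem_Icc.1 ((mem_indexFinset.1 hi).2 j)
  have hs := hg.2 j
  rw [mem_plainWordsFinset, subwords, subword_firstPos hs]
  refine ⟨?_, fun h => h2 (List.mem_of_mem_take (List.mem_of_mem_drop h))⟩
  rw [List.length_drop, List.length_take, h1]
  omega

/-- The positions, counted from `0`, of the subwords. -/
def window {k : ℕ} (s : ℕ) (i : Fin k → ℕ) : Finset ℕ :=
  univ.biUnion fun j => Ico (i j - s) (i j)

theorem pairwiseDisjoint_window {k s : ℕ} {i : Fin k → ℕ} (hg : Good s i) :
    Set.PairwiseDisjoint (univ : Finset (Fin k)) fun j => Ico (i j - s) (i j) := by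
  intro a _ b _ hab
  have h : Disjoint (Icc (firstPos s (i a)) (i a)) (Icc (firstPos s (i b)) (i b)) := hg.1 hab
  have ha := hg.2 a
  have hb := hg.2 b
  simp only [Function.onFun]
  rw [disjoint_left] at h ⊢
  intro x hx hx'
  rw [mem_Ico] at hx hx'
  -- The shift passes from positions counted from 0 to positions counted from 1.
  refine @h (x + 1) ?_ ?_ <;> rw [mem_Icc, firstPos] <;> omega

theorem card_window {k s : ℕ} {i : Fin k → ℕ} (hg : Good s i) : #(window s i) = k * s := by
  rw [window, card_biUnion (pairwiseDisjoint_window hg)]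
  simp only [Nat.card_Ico]
  rw [sum_congr rfl fun j _ => Nat.sub_sub_self (hg.2 j)]
  simp

theorem restrict_window_eq {k s : ℕ} {i : Fin k → ℕ} (hg : Good s i) {W W' : List Letter}
    (h : subwords s W i = subwords s W' i) : restrict (window s i) W = restrict (window s i) W' := by
  rw [restrict_eq_iff]
  intro u hu
  simp only [window, mem_biUnion, mem_univ, true_and, mem_Ico] at hu
  obtain ⟨j, h1, h2⟩ := hu
  have hj := congrFun h j
  rw [subwords, subwords, subword_firstPos (hg.2 j), subword_firstPos (hg.2 j)] at hj
  have := congrArg (fun l : List Letter => l[u - (i j - s)]?) hj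
  simpa [List.getElem?_drop, List.getElem?_take, Nat.add_sub_cancel' h1, h2] using this

/-- The total entropy defect at the positions of the subwords. -/
noncomputable def windowDefect (n : ℕ) {k : ℕ} (s : ℕ) (i : Fin k → ℕ) : ℝ :=
  ∑ j, ∑ u ∈ Ico (i j - s) (i j), entropyDefect n u

theorem windowDefect_nonneg {n k : ℕ} (s : ℕ) {i : Fin k → ℕ} (hi : i ∈ indexFinset n k) :
    0 ≤ windowDefect n s i := by
  refine sum_nonneg fun j _ => sum_nonneg fun u hu => entropyDefect_nonneg ?_
  have := (mem_Icc.1 ((mem_indexFinset.1 hi).2 j)).2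
  have := (mem_Ico.1 hu).2
  omega

-- For good `i` the subwords determine the letters on a window of exactly `k * s` positions, so
-- their entropy deficit relative to `log (4 ^ (k * s))` is at most the window defect.
open Classical in
theorem abs_sub_le_of_good {n k s : ℕ} {i : Fin k → ℕ} (hi : i ∈ indexFinset n k) (hg : Good s i)
    (A : Set (Fin k → List Letter)) :
    |(#{W ∈ thetaFinset n | subwords s W i ∈ A} : ℝ) / #(thetaFinset n) -
      (#{v ∈ plainTuplesFinset k s | v ∈ A} : ℝ) / #(plainTuplesFinset k s)| ≤
      2 * √(windowDefect n s i) := by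
  refine (abs_card_div_sub_le (f := fun W => subwords s W i) (fun W hW => subwords_mem hi hg hW)
    (thetaFinset_nonempty n) A).trans ?_
  gcongr
  have h1 := card_mul_log_add_meanLogFiber_le n (window s i)
  rw [card_window hg, window, sum_biUnion (pairwiseDisjoint_window hg), ← window] at h1
  have h2 : meanLogFiber (thetaFinset n) (fun W => subwords s W i) ≤
      meanLogFiber (thetaFinset n) (restrict (window s i)) :=
    meanLogFiber_mono fun W _ W' _ h => restrict_window_eq hg h
  rw [card_plainTuplesFinset, windowDefect]
  push_cast [log_pow] at h1 ⊢
  linarith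

theorem card_div_card_mem_Icc {α : Type*} (S : Finset α) (P : α → Prop) [DecidablePred P] :
    0 ≤ (#{a ∈ S | P a} : ℝ) / #S ∧ (#{a ∈ S | P a} : ℝ) / #S ≤ 1 := by
  refine ⟨by positivity, div_le_one_of_le₀ ?_ (by positivity)⟩
  exact_mod_cast card_filter_le _ _

-- A bad tuple contributes at most 1 and a good one at most `2 * √(windowDefect n s i)`; concavity
-- of the square root then moves the average inside.
open Classical in
theorem tvDist_subwordLaw_le {n k s : ℕ} (hk : k ≤ 2 * n) :
    tvDist (subwordLaw n k s hk) (idealLaw n k s hk) ≤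
      (#{i ∈ indexFinset n k | ¬ Good s i} : ℝ) / #(indexFinset n k) +
        2 * √((∑ i ∈ indexFinset n k, windowDefect n s i) / #(indexFinset n k)) := by
  have hM : (0 : ℝ) < #(indexFinset n k) := by
    exact_mod_cast card_pos.2 (indexFinset_nonempty hk)
  refine Real.iSup_le (fun A => ?_) (by positivity)
  rw [prob_subwordLaw, prob_idealLaw, ← sub_div, ← sum_sub_distrib, abs_div,
    abs_of_pos hM]
  have h1 : |∑ i ∈ indexFinset n k,
      ((#{W ∈ thetaFinset n | (i, subwords s W i) ∈ A} : ℝ) / #(thetaFinset n) -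
        (#{v ∈ plainTuplesFinset k s | (i, v) ∈ A} : ℝ) / #(plainTuplesFinset k s))| ≤
      #{i ∈ indexFinset n k | ¬ Good s i} +
        2 * ∑ i ∈ indexFinset n k, √(windowDefect n s i) := by
    rw [← sum_boole, mul_sum, ← sum_add_distrib]
    refine (abs_sum_le_sum_abs _ _).trans (sum_le_sum fun i hi => ?_)
    by_cases hg : Good s i
    · have := abs_sub_le_of_good hi hg {v | (i, v) ∈ A}
      simpa [hg] using this
    · rw [if_pos hg]
      have e1 := card_div_card_mem_Icc (thetaFinset n) fun W => (i, subwords s W i) ∈ A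
      have e2 := card_div_card_mem_Icc (plainTuplesFinset k s) fun v => (i, v) ∈ A
      have e3 := sqrt_nonneg (windowDefect n s i)
      rw [abs_le]
      constructor <;> linarith [e1.1, e1.2, e2.1, e2.2]
  have h2 : (∑ i ∈ indexFinset n k, √(windowDefect n s i)) / #(indexFinset n k) ≤
      √((∑ i ∈ indexFinset n k, windowDefect n s i) / #(indexFinset n k)) := by
    apply le_sqrt_of_sq_le
    have := sq_sum_le_card_mul_sum_sq (s := indexFinset n k)
      (f := fun i => √(windowDefect n s i))
    rw [sum_congr rfl fun i hi => sq_sqrt (windowDefect_nonneg s hi)] at this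
    rw [div_pow, div_le_div_iff₀ (by positivity) hM, sq (#(indexFinset n k) : ℝ)]
    nlinarith
  calc _ ≤ (#{i ∈ indexFinset n k | ¬ Good s i} +
        2 * ∑ i ∈ indexFinset n k, √(windowDefect n s i)) / #(indexFinset n k) := by gcongr
    _ = (#{i ∈ indexFinset n k | ¬ Good s i} : ℝ) / #(indexFinset n k) +
        2 * ((∑ i ∈ indexFinset n k, √(windowDefect n s i)) / #(indexFinset n k)) := by ring
    _ ≤ _ := by gcongr

end Laws

/-! ### Bounds under the growth condition -/

section Asymptotics

variable {n k s : ℕ} {δ : ℝ}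

/-- The growth condition enters only through these bounds, which serve the overlaps, the cut-off
windows and the entropy in turn. -/
theorem cube_mul_sq_bounds (h : (k : ℝ) ^ 3 * (s : ℝ) ^ 2 ≤ δ * n) :
    (k : ℝ) ^ 2 * s ≤ δ * n ∧ (k : ℝ) * s ≤ δ * n ∧ ((k : ℝ) * s) ^ 2 ≤ δ * n := by
  have hk : (k : ℝ) ^ 2 ≤ k ^ 3 := by
    rcases Nat.eq_zero_or_pos k with rfl | hk
    · simp
    · exact_mod_cast Nat.pow_le_pow_right hk (by norm_num)
  have hk' : (k : ℝ) ≤ k ^ 3 := by exact_mod_cast Nat.le_self_pow (by norm_num) k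
  have hs : (s : ℝ) ≤ s ^ 2 := by exact_mod_cast Nat.le_self_pow (by norm_num) s
  refine ⟨le_trans ?_ h, le_trans ?_ h, le_trans ?_ h⟩
  · gcongr
  · gcongr
  · rw [mul_pow]
    gcongr

open Classical in
theorem card_overlap_div_le (hk : k ≤ 2 * n) (hδ : 0 ≤ δ)
    (h : (k : ℝ) ^ 3 * (s : ℝ) ^ 2 ≤ δ * n) :
    (#{i ∈ indexFinset n k | ¬ Nonoverlapping s i} : ℝ) / #(indexFinset n k) ≤ δ := by
  rcases Nat.eq_zero_or_pos n with rfl | hn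
  · obtain rfl : k = 0 := by omega
    have : ∀ i : Fin 0 → ℕ, Nonoverlapping s i := fun i a => a.elim0
    simpa [this] using hδ
  have hn' : (0 : ℝ) < n := by exact_mod_cast hn
  refine div_le_of_le_mul₀ (by positivity) hδ (le_of_mul_le_mul_left ?_ hn')
  refine (card_filter_overlap_le n k s).trans ?_
  rw [← mul_assoc, mul_comm (n : ℝ)]
  exact mul_le_mul_of_nonneg_right (cube_mul_sq_bounds h).1 (by positivity)

open Classical in
theorem card_cut_off_div_le (hk : k ≤ 2 * n) (hδ : 0 ≤ δ)
    (h : (k : ℝ) ^ 3 * (s : ℝ) ^ 2 ≤ δ * n) :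
    (#{i ∈ indexFinset n k | ∃ j, i j < s} : ℝ) / #(indexFinset n k) ≤ δ := by
  rcases Nat.eq_zero_or_pos n with rfl | hn
  · obtain rfl : k = 0 := by omega
    simpa using hδ
  have hn' : (0 : ℝ) < n := by exact_mod_cast hn
  refine div_le_of_le_mul₀ (by positivity) hδ (le_of_mul_le_mul_left ?_ hn')
  refine (card_filter_lt_le n k s).trans ?_
  rw [← mul_assoc, mul_comm (n : ℝ)]
  exact mul_le_mul_of_nonneg_right (cube_mul_sq_bounds h).2.1 (by positivity)

open Classical in
theorem card_not_good_div_le (hk : k ≤ 2 * n) (hδ : 0 ≤ δ)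
    (h : (k : ℝ) ^ 3 * (s : ℝ) ^ 2 ≤ δ * n) :
    (#{i ∈ indexFinset n k | ¬ Good s i} : ℝ) / #(indexFinset n k) ≤ 2 * δ := by
  have h1 : (#{i ∈ indexFinset n k | ¬ Good s i} : ℝ) ≤
      #{i ∈ indexFinset n k | ¬ Nonoverlapping s i} +
        #{i ∈ indexFinset n k | ∃ j, i j < s} := by
    norm_cast
    refine le_trans (card_le_card fun i hi => ?_) (card_union_le _ _)
    simp only [Good, mem_filter, mem_union, not_and_or, not_forall, not_le] at hi ⊢
    tauto
  calc _ ≤ ((#{i ∈ indexFinset n k | ¬ Nonoverlapping s i} : ℝ) +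
        #{i ∈ indexFinset n k | ∃ j, i j < s}) / #(indexFinset n k) := by gcongr
    _ ≤ 2 * δ := by
        rw [add_div, two_mul]
        exact add_le_add (card_overlap_div_le hk hδ h) (card_cut_off_div_le hk hδ h)

/-- Crude, but `√n` is just what `k * s ≤ √δ * √n` can absorb. -/
theorem log_add_one_le_two_mul_sqrt {x : ℝ} (hx : 0 ≤ x) : log (x + 1) ≤ 2 * √x := by
  have h0 := sqrt_nonneg x
  have h1 : x + 1 ≤ (1 + √x) ^ 2 := by nlinarith [sq_sqrt hx]
  have h2 := log_le_log (by positivity) h1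
  have h3 := log_le_sub_one_of_pos (by positivity : 0 < 1 + √x)
  rw [log_pow] at h2
  push_cast at h2
  linarith

theorem mean_windowDefect_le (hk : k ≤ 2 * n) (hδ : 0 ≤ δ)
    (h : (k : ℝ) ^ 3 * (s : ℝ) ^ 2 ≤ δ * n) :
    (∑ i ∈ indexFinset n k, windowDefect n s i) / #(indexFinset n k) ≤ 6 * √δ := by
  rcases Nat.eq_zero_or_pos n with rfl | hn
  · obtain rfl : k = 0 := by omega
    simp [windowDefect]
  have hn' : (0 : ℝ) < n := by exact_mod_cast hn
  have h1 : (k : ℝ) * s ≤ √δ * √n := by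
    rw [← sqrt_mul hδ]
    exact le_sqrt_of_sq_le (cube_mul_sq_bounds h).2.2
  have h2 : ∑ u ∈ range (2 * n), entropyDefect n u ≤ 12 * √n := by
    have := sum_entropyDefect_le n
    have := log_add_one_le_two_mul_sqrt hn'.le
    linarith
  refine div_le_of_le_mul₀ (by positivity) (by positivity)
    (le_of_mul_le_mul_left ?_ (by positivity : (0 : ℝ) < 2 * n))
  calc (2 * n : ℝ) * ∑ i ∈ indexFinset n k, windowDefect n s i
      ≤ k * #(indexFinset n k) * (s * ∑ u ∈ range (2 * n), entropyDefect n u) :=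
        sum_window_entropyDefect_le n k s
    _ ≤ k * #(indexFinset n k) * (s * (12 * √n)) := by gcongr
    _ = (k * s) * (12 * √n * #(indexFinset n k)) := by ring
    _ ≤ (√δ * √n) * (12 * √n * #(indexFinset n k)) := by gcongr
    _ = 2 * n * (6 * √δ * #(indexFinset n k)) := by
        linear_combination (12 * √δ * #(indexFinset n k)) * mul_self_sqrt hn'.le

end Asymptotics

end BurgerWords

theorem theorem4p2 (ε : ℝ) (hε : 0 < ε) :
    ∃ δ : ℝ, 0 < δ ∧ ∀ (n k s : ℕ) (hk : k ≤ 2 * n), (k : ℝ) ^ 3 * (s : ℝ) ^ 2 ≤ δ * (n : ℝ) →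
      1 - ε ≤ BurgerWords.prob (BurgerWords.sample n k hk)
          {x | BurgerWords.Nonoverlapping s x.2} ∧
      BurgerWords.tvDist (BurgerWords.subwordLaw n k s hk) (BurgerWords.idealLaw n k s hk) ≤ ε := by
  classical
  -- The first bound makes the bad tuples cost `2 * δ ≤ ε / 2`. The second gives `6 * √δ ≤ (ε / 4) ^
  -- 2`, so the entropy term `2 * √(6 * √δ)` is at most `ε / 2`.
  refine ⟨min (ε / 4) ((ε ^ 2 / 96) ^ 2), by positivity, fun n k s hk h => ?_⟩
  set δ := min (ε / 4) ((ε ^ 2 / 96) ^ 2) with hδ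
  have hδ0 : 0 ≤ δ := by positivity
  have hδ1 : δ ≤ ε / 4 := min_le_left _ _
  have hδ2 : √δ ≤ ε ^ 2 / 96 := sqrt_le_left (by positivity) |>.2 (min_le_right _ _)
  constructor
  · rw [BurgerWords.prob_sample_snd hk fun i => BurgerWords.Nonoverlapping s i]
    have h1 := BurgerWords.card_overlap_div_le hk hδ0 h
    have hM : (0 : ℝ) < #(BurgerWords.indexFinset n k) := by
      exact_mod_cast card_pos.2 (BurgerWords.indexFinset_nonempty hk)
    have h2 : (#{i ∈ BurgerWords.indexFinset n k | BurgerWords.Nonoverlapping s i} : ℝ) +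
        #{i ∈ BurgerWords.indexFinset n k | ¬ BurgerWords.Nonoverlapping s i} =
          #(BurgerWords.indexFinset n k) := by
      exact_mod_cast card_filter_add_card_filter_not _
    rw [div_le_iff₀ hM] at h1
    rw [le_div_iff₀ hM]
    nlinarith
  · refine (BurgerWords.tvDist_subwordLaw_le hk).trans ?_
    have h1 := BurgerWords.card_not_good_div_le hk hδ0 h
    have h2 := BurgerWords.mean_windowDefect_le hk hδ0 h
    have h3 : √((∑ i ∈ BurgerWords.indexFinset n k, BurgerWords.windowDefect n s i) /
        #(BurgerWords.indexFinset n k)) ≤ ε / 4 := by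
      refine sqrt_le_left (by positivity) |>.2 (h2.trans ?_)
      calc 6 * √δ ≤ 6 * (ε ^ 2 / 96) := by gcongr
        _ = (ε / 4) ^ 2 := by ring
    linarith
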